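/- Let $S$ be a finite or countable set with $|S|>1$, and let $P(y|x)$, $x,y\in S$, be the transition probabilities of an irreducible Markov chain on $S$ with stationary probability distribution $\pi$. For $x\in S$ let $\alpha(x)=1-P(x|x)=\sum_{y\neq x}P(y|x)$, which is positive, and put $\widehat P(x|x)=0$ and $\widehat P(y|x)=P(y|x)/\alpha(x)$ for $y\neq x$. Let $h:S\to\mathbf R$ be a function with $\sum_{x\in S}\pi(x)\,|h(x)|<\infty$. Let $J_1,J_2,\ldots$ be a Markov chain on $S$ with transition probabilities $\widehat P$ and an arbitrary initial distribution, and, given the sequence $(J_k)_{k\ge1}$, let $M_1,M_2,\ldots$ be conditionally independent with $$\mathbf P[M_k=m \mid (J_j)_{j\ge 1}]=(1-\alpha(J_k))^{m-1}\,\alpha(J_k),\qquad m=1,2,\ldots$$ (that is, $M_k$ is distributed as $1+G$ where $G$ is geometric with success probability $\alpha(J_k)$). Then, with probability $1$, $$\lim_{L\to\infty}\frac{\sum_{k=1}^L M_k\,h(J_k)}{\sum_{k=1}^L M_k}=\mathbf E_\pi(h)=\sum_{x\in S}h(x)\,\pi(x).$$ -/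

import Mathlib

open MeasureTheory Filter Topology
open scoped ENNReal

namespace JumpChain

/-- A transition probability function is a map `P : S → PMF S`; `P x y` is the probability `P(y|x)`
of moving from `x` to `y`. It is irreducible if any two states are joined by a finite path of
transitions of positive probability. -/
def IsIrreducible {S : Type*} (P : S → PMF S) : Prop :=
  ∀ x y : S, Relation.ReflTransGen (fun a b => 0 < P a b) x y

/-- `π` is a stationary probability distribution of `P`. -/
def IsStationary {S : Type*} (P : S → PMF S) (π : PMF S) : Prop :=
  ∀ y : S, ∑' x : S, π x * P x y = π y

/-- The escape probability `α(x) = 1 - P(x|x)`. -/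
noncomputable def escapeProb {S : Type*} (P : S → PMF S) (x : S) : ℝ≥0∞ :=
  1 - P x x

/-- The escape probability is the total probability of moving to another state. -/
theorem escapeProb_eq_tsum {S : Type*} (P : S → PMF S) (x : S) :
    escapeProb P x = ∑' y : {y : S // y ≠ x}, P x y := by
  have h := ENNReal.summable.tsum_add_tsum_compl (f := fun y => P x y) (s := ({x} : Set S))
    ENNReal.summable
  rw [(P x).tsum_coe, tsum_singleton x (fun y => P x y)] at h
  rw [escapeProb, ← h]
  exact ENNReal.add_sub_cancel_left ((P x).apply_ne_top x)

open Classical in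
/-- The transition probabilities of the jump chain: `0` on the diagonal and `P(y|x) / α(x)` for
`y ≠ x`. -/
noncomputable def jumpProb {S : Type*} (P : S → PMF S) (x y : S) : ℝ≥0∞ :=
  if y = x then 0 else P x y / escapeProb P x

/-- The point probabilities of `1 + G`, with `G` geometric (number of failures) of success
probability `p`: the value `m ≥ 1` has probability `(1 - p) ^ (m - 1) * p`. -/
noncomputable def multProb (p : ℝ≥0∞) (m : ℕ) : ℝ≥0∞ :=
  if m = 0 then 0 else (1 - p) ^ (m - 1) * p

/-- `X 0, X 1, …` is, under `μ`, a time-homogeneous Markov chain with transition probabilities `Q`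
and an arbitrary initial distribution: `X (n + 1)` has conditional distribution `Q (X n) ·` given
`X 0, …, X n`. -/
def IsMarkovChain {Ω S : Type*} [MeasurableSpace Ω] [MeasurableSpace S]
    (μ : Measure Ω) (Q : S → S → ℝ≥0∞) (X : ℕ → Ω → S) : Prop :=
  (∀ n, Measurable (X n)) ∧
    ∀ (n : ℕ) (x : ℕ → S),
      μ {ω | ∀ k ≤ n + 1, X k ω = x k} = μ {ω | ∀ k ≤ n, X k ω = x k} * Q (x n) (x (n + 1))

/-- Given the sequence `J`, the variables `M 0, M 1, …` are, under `μ`, independent, and `M k` is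
distributed as `1 + G` with `G` geometric of success probability `α (J k)`. -/
def IsMultiplicityList {Ω S : Type*} [MeasurableSpace Ω]
    (μ : Measure Ω) (α : S → ℝ≥0∞) (J : ℕ → Ω → S) (M : ℕ → Ω → ℕ) : Prop :=
  (∀ n, Measurable (M n)) ∧
    ∀ (n : ℕ) (x : ℕ → S) (m : ℕ → ℕ),
      μ {ω | ∀ k ≤ n, J k ω = x k ∧ M k ω = m k} =
        μ {ω | ∀ k ≤ n, J k ω = x k} * ∏ k ∈ Finset.range (n + 1), multProb (α (x k)) (m k)

/-- The estimator `(∑_{k=1}^L M_k h(J_k)) / ∑_{k=1}^L M_k`. -/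
noncomputable def weightedEstimator {Ω S : Type*} (h : S → ℝ) (J : ℕ → Ω → S) (M : ℕ → Ω → ℕ)
    (L : ℕ) (ω : Ω) : ℝ :=
  (∑ k ∈ Finset.Icc 1 L, (M k ω : ℝ) * h (J k ω)) / ∑ k ∈ Finset.Icc 1 L, (M k ω : ℝ)

end JumpChain

/-!
The pairs `Y k = (J k, M k)` form a Markov chain on `S × ℕ`: from `(x, m)` it moves to `(y, m')`
with probability `jumpProb P x y * multProb (α y) m'`, where `α = escapeProb P`. Stationarity of
`π` for `P` says that the weights `π x * α x` are stationary for the jump chain, so the weights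
`π x * α x * multProb (α x) m`, divided by their total mass `c`, form a stationary distribution of
`Y` (`isStationary_pairStationary`). Numerator and denominator of the estimator are sums along `Y`
of the functions `m * h x` and `m`. Their stationary means are `c⁻¹ * ∑ π x * h x` and `c⁻¹`, since
the mean `1 / α x` of the multiplicity at `x` cancels the factor `α x` (`hasSum_pairStationary`).
The ergodic theorem for `Y` (`MarkovPath.ae_tendsto_average`) therefore gives the limit of the
estimator as the quotient of the two means.

The ergodic theorem for a chain on a countable set is deduced from Birkhoff's theorem for the shift
on path space, in three steps.

* Birkhoff's theorem for an ergodic map `T` rests on `integral_nonneg_of_not_bddAbove`: the maxima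
  `Φ n` of the first Birkhoff sums of `f` satisfy `Φ (n + 1) = f + max 0 (Φ n ∘ T)`, so, where the
  sums are unbounded, `Φ (n + 1) - Φ n ∘ T` is eventually equal to `f`, while its integral is
  nonnegative since `Φ` is increasing and `T` preserves the measure. By ergodicity, a function of
  negative integral thus has Birkhoff sums bounded above almost everywhere; apply this to
  `± (f - ∫ f) - ε`.
* The shift is ergodic under the law of the stationary chain (`ergodic_shift`): the probability of
  an invariant event, as a function of the initial state, is harmonic, hence constant
  (`harmonic_eq_of_step`), so the event is independent of the past and thus of itself.
* The law of a chain is the mixture of the laws `pathLaw Q x` according to its initial distribution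
  (`map_path_eq_mixLaw`), so a chain that starts in states charged by the stationary distribution
  has a law absolutely continuous with respect to that of the stationary chain.

The laws `pathLaw Q x` are realized by a family, indexed by times and states, of independent
instructions where to go next.
-/

/-! ### Path measures of a Markov chain -/

namespace MarkovPath

/-- The cylinder of the paths that agree with `w` up to time `n`. -/
def cyl {E : Type*} (n : ℕ) (w : ℕ → E) : Set (ℕ → E) := {ω | ∀ k ≤ n, ω k = w k}

/-- The shift `(ω 0, ω 1, …) ↦ (ω 1, ω 2, …)` on path space. -/
def shift {E : Type*} (ω : ℕ → E) : ℕ → E := fun k => ω (k + 1)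

theorem shift_iterate {E : Type*} (n : ℕ) (ω : ℕ → E) (k : ℕ) :
    (shift^[n] ω) k = ω (k + n) := by
  induction n generalizing ω with
  | zero => simp
  | succ n ih =>
    rw [Function.iterate_succ_apply, ih, shift]
    congr 1

theorem measurable_shift {E : Type*} [MeasurableSpace E] : Measurable (shift (E := E)) :=
  measurable_pi_lambda _ fun k => measurable_pi_apply (k + 1)

theorem measurableSet_cyl {E : Type*} [MeasurableSpace E] [MeasurableSingletonClass E] (n : ℕ)
    (w : ℕ → E) : MeasurableSet (cyl n w) := by
  have : cyl n w = ⋂ k, ⋂ (_ : k ≤ n), (fun ω : ℕ → E => ω k) ⁻¹' {w k} := by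
    ext ω; simp [cyl]
  rw [this]
  exact MeasurableSet.iInter fun k => MeasurableSet.iInter fun _ =>
    measurable_pi_apply k (measurableSet_singleton _)

theorem isPiSystem_cyl {E : Type*} :
    IsPiSystem (Set.range fun p : ℕ × (ℕ → E) => cyl p.1 p.2) := by
  rintro _ ⟨⟨n, w⟩, rfl⟩ _ ⟨⟨m, v⟩, rfl⟩ ⟨z, hz₁, hz₂⟩
  refine ⟨⟨max n m, z⟩, ?_⟩
  ext ω
  simp only [cyl, Set.mem_ofPred_eq, Set.mem_inter_iff, le_max_iff] at *
  constructor
  · intro h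
    exact ⟨fun k hk => (h k (.inl hk)).trans (hz₁ k hk), fun k hk => (h k (.inr hk)).trans (hz₂ k hk)⟩
  · rintro ⟨h₁, h₂⟩ k (hk | hk)
    · exact (h₁ k hk).trans (hz₁ k hk).symm
    · exact (h₂ k hk).trans (hz₂ k hk).symm

/-- Extension of a finite word to an infinite path; the values beyond the word are irrelevant. -/
def extendWord {E : Type*} {n : ℕ} (v : Fin (n + 1) → E) : ℕ → E :=
  fun k => if h : k < n + 1 then v ⟨k, h⟩ else v 0

theorem generateFrom_cyl {E : Type*} [Countable E] [MeasurableSpace E]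
    [MeasurableSingletonClass E] :
    (inferInstance : MeasurableSpace (ℕ → E)) =
      MeasurableSpace.generateFrom (Set.range fun p : ℕ × (ℕ → E) => cyl p.1 p.2) := by
  refine le_antisymm ?_ (MeasurableSpace.generateFrom_le ?_)
  · refine iSup_le fun k => ?_
    rintro _ ⟨s, -, rfl⟩
    have : (fun ω : ℕ → E => ω k) ⁻¹' s =
        ⋃ v : {v : Fin (k + 1) → E // v (Fin.last k) ∈ s}, cyl k (extendWord v.1) := by
      ext ω
      simp only [Set.mem_preimage, Set.mem_iUnion, cyl, Set.mem_ofPred_eq]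
      constructor
      · intro h
        refine ⟨⟨fun i => ω i, h⟩, fun j hj => ?_⟩
        simp [extendWord, Nat.lt_succ_of_le hj]
      · rintro ⟨⟨v, hv⟩, h⟩
        rw [h k le_rfl]
        simpa [extendWord, Fin.last] using hv
    rw [this]
    exact MeasurableSet.iUnion fun v => MeasurableSpace.measurableSet_generateFrom ⟨⟨k, _⟩, rfl⟩
  · rintro _ ⟨⟨n, w⟩, rfl⟩
    exact measurableSet_cyl n w

/-- A finite measure on path space is determined by its values on cylinders. -/
theorem ext_cyl {E : Type*} [Countable E] [MeasurableSpace E] [MeasurableSingletonClass E]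
    {m₁ m₂ : Measure (ℕ → E)} [IsFiniteMeasure m₁] (h : ∀ n w, m₁ (cyl n w) = m₂ (cyl n w)) :
    m₁ = m₂ := by
  refine Measure.ext_of_generateFrom_of_cover_subset (generateFrom_cyl (E := E)) isPiSystem_cyl
    (T := Set.range fun a : E => cyl 0 fun _ => a) ?_ (Set.countable_range _) ?_ ?_ ?_
  · rintro _ ⟨a, rfl⟩
    exact ⟨⟨0, fun _ => a⟩, rfl⟩
  · refine Set.eq_univ_of_forall fun ω => ?_
    exact ⟨_, ⟨ω 0, rfl⟩, by simp [cyl]⟩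
  · rintro _ ⟨a, rfl⟩
    exact measure_ne_top _ _
  · rintro _ ⟨⟨n, w⟩, rfl⟩
    exact h n w

/-- The product of the transition probabilities along the first `n` steps of `w`. -/
noncomputable def weight {E : Type*} (Q : E → PMF E) (n : ℕ) (w : ℕ → E) : ℝ≥0∞ :=
  ∏ i ∈ Finset.range n, Q (w i) (w (i + 1))

/-- The path from `x` that follows the instructions `u`: at time `n` it moves from its position
`y` to `u (n, y)`. -/
def follow {E : Type*} (u : ℕ × E → E) (x : E) : ℕ → E
  | 0 => x
  | n + 1 => u (n, follow u x n)

variable {E : Type*} [Countable E] [MeasurableSpace E] [MeasurableSingletonClass E]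

theorem measurable_follow (x : E) : Measurable fun u : ℕ × E → E => follow u x := by
  refine measurable_pi_lambda _ fun n => ?_
  induction n with
  | zero => exact measurable_const
  | succ n ih =>
    have : Measurable fun p : (ℕ × E → E) × E => p.1 (n, p.2) :=
      measurable_from_prod_countable_left fun y => measurable_pi_apply (n, y)
    exact this.comp (measurable_id.prodMk ih)

/-- The law of the chain with transition probabilities `Q` started at `x`: the law of the path
that follows independent instructions `u (n, y)` of distribution `Q y`. -/
noncomputable def pathLaw (Q : E → PMF E) (x : E) : Measure (ℕ → E) :=
  (Measure.infinitePi fun p : ℕ × E => (Q p.2).toMeasure).map fun u => follow u x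

instance (Q : E → PMF E) (x : E) : IsProbabilityMeasure (pathLaw Q x) :=
  Measure.isProbabilityMeasure_map (measurable_follow x).aemeasurable

theorem pathLaw_cyl (Q : E → PMF E) (n : ℕ) (w : ℕ → E) :
    pathLaw Q (w 0) (cyl n w) = weight Q n w := by
  classical
  rw [pathLaw, Measure.map_apply (measurable_follow _) (measurableSet_cyl n w)]
  have hset : (fun u : ℕ × E → E => follow u (w 0)) ⁻¹' cyl n w =
      Set.pi ((Finset.range n).image fun i => (i, w i)) fun p => {w (p.1 + 1)} := by
    ext u
    simp only [Set.mem_preimage, cyl, Set.mem_ofPred_eq, Set.mem_pi, Finset.coe_image,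
      Set.mem_image, Finset.coe_range, Set.mem_Iio, Set.mem_singleton_iff, forall_exists_index,
      and_imp]
    constructor
    · rintro h _ i hi rfl
      have := h (i + 1) hi
      rwa [follow, h i hi.le] at this
    · intro h k hk
      induction k with
      | zero => rfl
      | succ k ih => rw [follow, ih (by omega)]; exact h _ k (by omega) rfl
  rw [hset, Measure.infinitePi_pi _ fun _ _ => measurableSet_singleton _,
    Finset.prod_image fun i _ j _ h => congrArg Prod.fst h]
  exact Finset.prod_congr rfl fun i _ =>
    PMF.toMeasure_apply_singleton _ _ (measurableSet_singleton _)

theorem pathLaw_cyl_of_ne (Q : E → PMF E) {x : E} {n : ℕ} {w : ℕ → E} (h : w 0 ≠ x) :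
    pathLaw Q x (cyl n w) = 0 := by
  rw [pathLaw, Measure.map_apply (measurable_follow _) (measurableSet_cyl n w)]
  convert measure_empty
  · refine Set.eq_empty_of_forall_notMem fun u hu => h ?_
    exact (hu 0 (Nat.zero_le n)).symm
  · infer_instance

/-- The mixture of the laws `pathLaw Q x` with weights `a x`; for a probability distribution `a`
it is the law of the chain with initial distribution `a`. -/
noncomputable def mixLaw (Q : E → PMF E) (a : E → ℝ≥0∞) : Measure (ℕ → E) :=
  Measure.sum fun x => a x • pathLaw Q x

theorem mixLaw_apply {E : Type*} [MeasurableSpace E] (Q : E → PMF E) (a : E → ℝ≥0∞) {B : Set (ℕ → E)} (hB : MeasurableSet B) :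
    mixLaw Q a B = ∑' x, a x * pathLaw Q x B := by
  simp [mixLaw, Measure.sum_apply _ hB]

theorem mixLaw_cyl (Q : E → PMF E) (a : E → ℝ≥0∞) (n : ℕ) (w : ℕ → E) :
    mixLaw Q a (cyl n w) = a (w 0) * weight Q n w := by
  rw [mixLaw_apply Q a (measurableSet_cyl n w), tsum_eq_single (w 0), pathLaw_cyl]
  intro x hx
  rw [pathLaw_cyl_of_ne Q hx.symm, mul_zero]

instance (Q : E → PMF E) (ρ : PMF E) : IsProbabilityMeasure (mixLaw Q ρ) :=
  ⟨by simp [mixLaw_apply Q ρ .univ, ρ.tsum_coe]⟩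

/-- A finite measure on path space is a mixture of path laws as soon as its values on cylinders
have the product form. -/
theorem eq_mixLaw {Q : E → PMF E} {a : E → ℝ≥0∞} {m : Measure (ℕ → E)} [IsFiniteMeasure m]
    (h : ∀ n w, m (cyl n w) = a (w 0) * weight Q n w) : m = mixLaw Q a :=
  ext_cyl fun n w => by rw [h, mixLaw_cyl]

theorem weight_succ' {E : Type*} (Q : E → PMF E) (n : ℕ) (w : ℕ → E) :
    weight Q (n + 1) w = Q (w 0) (w 1) * weight Q n (shift w) := by
  simp [weight, Finset.prod_range_succ', mul_comm, shift]

/-- First-step decomposition: the shifted path from `x` is a chain started from `Q x`. -/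
theorem map_shift_pathLaw (Q : E → PMF E) (x : E) :
    (pathLaw Q x).map shift = mixLaw Q (Q x) := by
  have := Measure.isFiniteMeasure_map (pathLaw Q x) shift
  refine eq_mixLaw fun n w => ?_
  rw [Measure.map_apply measurable_shift (measurableSet_cyl n w)]
  have h0 : ∀ᵐ ω ∂pathLaw Q x, ω 0 = x :=
    (ae_map_iff (measurable_follow x).aemeasurable
      (measurableSet_eq_fun (measurable_pi_apply 0) measurable_const)).2
      (Eventually.of_forall fun u => rfl)
  let v : ℕ → E := fun k => Nat.casesOn k x w
  have hae : (shift ⁻¹' cyl n w : Set (ℕ → E)) =ᵐ[pathLaw Q x] cyl (n + 1) v := by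
    filter_upwards [h0] with ω hω
    refine propext ⟨fun h k hk => ?_, fun h k hk => h (k + 1) (by omega)⟩
    cases k with
    | zero => exact hω
    | succ k => exact h k (by omega)
  rw [measure_congr hae]
  exact (pathLaw_cyl Q (n + 1) v).trans (weight_succ' Q n v)

theorem pathLaw_shift_preimage (Q : E → PMF E) (x : E) {B : Set (ℕ → E)} (hB : MeasurableSet B) :
    pathLaw Q x (shift ⁻¹' B) = ∑' y, Q x y * pathLaw Q y B := by
  rw [← Measure.map_apply measurable_shift hB, map_shift_pathLaw, mixLaw_apply Q _ hB]

/-- The Markov property at time `n`: given the path up to time `n`, the path from then on has law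
`pathLaw Q (x n)`. -/
theorem mixLaw_cyl_inter (Q : E → PMF E) {a : E → ℝ≥0∞} [IsFiniteMeasure (mixLaw Q a)] (n : ℕ)
    (x : ℕ → E) {B : Set (ℕ → E)} (hB : MeasurableSet B) :
    mixLaw Q a (shift^[n] ⁻¹' B ∩ cyl n x) = mixLaw Q a (cyl n x) * pathLaw Q (x n) B := by
  have hs : Measurable (shift (E := E))^[n] := measurable_shift.iterate n
  have hfin := Measure.isFiniteMeasure_map ((mixLaw Q a).restrict (cyl n x)) shift^[n]
  have key : ((mixLaw Q a).restrict (cyl n x)).map shift^[n] =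
      mixLaw Q a (cyl n x) • pathLaw Q (x n) := by
    refine ext_cyl fun k w => ?_
    rw [Measure.map_apply hs (measurableSet_cyl k w),
      Measure.restrict_apply (hs (measurableSet_cyl k w)), Measure.smul_apply, smul_eq_mul]
    by_cases hw : w 0 = x n
    · let z : ℕ → E := fun j => if j ≤ n then x j else w (j - n)
      have hz1 : ∀ j ≤ n, z j = x j := fun j hj => if_pos hj
      have hz2 : ∀ j, z (n + j) = w j := fun j => by
        rcases Nat.eq_zero_or_pos j with rfl | hj
        · simp [z, hw]
        · simp only [z]; rw [if_neg (by omega)]; congr 1; omega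
      have hset : (shift^[n] ⁻¹' cyl k w ∩ cyl n x : Set (ℕ → E)) = cyl (n + k) z := by
        ext ω
        simp only [cyl, Set.mem_inter_iff, Set.mem_preimage, Set.mem_ofPred_eq, shift_iterate]
        constructor
        · rintro ⟨h₁, h₂⟩ j hj
          by_cases hjn : j ≤ n
          · rw [h₂ j hjn, hz1 j hjn]
          · obtain ⟨i, rfl⟩ := Nat.exists_eq_add_of_le (not_le.1 hjn).le
            rw [hz2, ← h₁ i (by omega), add_comm]
        · intro h
          exact ⟨fun i hi => by rw [add_comm, h _ (by omega), hz2],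
            fun j hj => by rw [h j (by omega), hz1 j hj]⟩
      rw [hset, mixLaw_cyl, mixLaw_cyl, ← hw, pathLaw_cyl, hz1 0 (Nat.zero_le n), mul_assoc]
      congr 1
      simp only [weight]
      rw [Finset.prod_range_add]
      congr 1
      · refine Finset.prod_congr rfl fun i hi => ?_
        have := Finset.mem_range.1 hi
        rw [hz1 i (by omega), hz1 (i + 1) (by omega)]
      · exact Finset.prod_congr rfl fun i _ => by rw [hz2, add_assoc, hz2]
    · rw [pathLaw_cyl_of_ne Q hw, mul_zero]
      convert measure_empty
      · refine Set.eq_empty_of_forall_notMem fun ω hω => hw ?_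
        have h1 := hω.1 0 (Nat.zero_le k)
        rw [shift_iterate, zero_add] at h1
        rw [← h1, hω.2 n le_rfl]
      · infer_instance
  have := congrArg (fun m => m B) key
  simpa only [Measure.map_apply hs hB, Measure.restrict_apply (hs hB), Measure.smul_apply,
    smul_eq_mul] using this

end MarkovPath

/-! ### Birkhoff's pointwise theorem for ergodic maps -/

namespace Birkhoff

variable {X : Type*} {T : X → X} {f : X → ℝ}

/-- `maxSum T f n` is the largest of the Birkhoff sums of `f` of lengths `1, …, n + 1`, defined
through the recursion that the proof of the maximal inequality uses. -/
def maxSum (T : X → X) (f : X → ℝ) : ℕ → X → ℝ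
  | 0 => f
  | n + 1 => fun x => f x + max 0 (maxSum T f n (T x))

theorem birkhoffSum_le_maxSum (n : ℕ) (x : X) :
    birkhoffSum T f (n + 1) x ≤ maxSum T f n x := by
  induction n generalizing x with
  | zero => simp [maxSum]
  | succ n ih =>
    rw [birkhoffSum_succ']
    exact add_le_add le_rfl ((ih _).trans (le_max_right _ _))

theorem monotone_maxSum (x : X) : Monotone fun n => maxSum T f n x := by
  refine monotone_nat_of_le_succ fun n => ?_
  induction n generalizing x with
  | zero => simp [maxSum]
  | succ n ih => exact add_le_add le_rfl (max_le_max le_rfl (ih _))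

variable [MeasurableSpace X] {μ : Measure X}

theorem integrable_maxSum (hT : MeasurePreserving T μ μ) (hf : Integrable f μ) (n : ℕ) :
    Integrable (maxSum T f n) μ := by
  induction n with
  | zero => exact hf
  | succ n ih =>
    exact hf.add (((integrable_zero X ℝ μ).sup (hT.integrable_comp_of_integrable ih)))

/-- Maximal inequality: if the Birkhoff sums of `f` are almost everywhere unbounded above, then
`f` has nonnegative integral. -/
theorem integral_nonneg_of_not_bddAbove (hT : MeasurePreserving T μ μ) (hf : Integrable f μ)
    (hA : ∀ᵐ x ∂μ, ¬ BddAbove (Set.range fun n => birkhoffSum T f n x)) :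
    0 ≤ ∫ x, f x ∂μ := by
  have hint := integrable_maxSum hT hf
  have hintT : ∀ n, Integrable (fun x => maxSum T f n (T x)) μ := fun n =>
    hT.integrable_comp_of_integrable (hint n)
  have hlim : Tendsto (fun n => ∫ x, (maxSum T f (n + 1) x - maxSum T f n (T x)) ∂μ) atTop
      (𝓝 (∫ x, f x ∂μ)) := by
    refine tendsto_integral_of_dominated_convergence (fun x => |f x| + |f (T x)|)
      (fun n => ((hint _).sub (hintT n)).1)
      (hf.abs.add (hT.integrable_comp_of_integrable hf).abs) (fun n => ?_) ?_
    · refine Eventually.of_forall fun x => ?_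
      have h0 : f (T x) ≤ maxSum T f n (T x) := monotone_maxSum (T x) (Nat.zero_le n)
      have : maxSum T f (n + 1) x - maxSum T f n (T x) = f x + max (-maxSum T f n (T x)) 0 := by
        simp only [maxSum]
        rcases le_total 0 (maxSum T f n (T x)) with h | h
        · rw [max_eq_right h, max_eq_right (by linarith)]; ring
        · rw [max_eq_left h, max_eq_left (by linarith)]; ring
      rw [this, Real.norm_eq_abs]
      refine (abs_add_le _ _).trans (add_le_add le_rfl ?_)
      rw [abs_of_nonneg (le_max_right _ _)]
      exact max_le (by linarith [neg_le_abs (f (T x))]) (abs_nonneg _)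
    · filter_upwards [hT.quasiMeasurePreserving.ae hA] with x hx
      -- the sums along the orbit of `T x` become positive, and from then on the integrand is `f x`
      obtain ⟨N, hN⟩ : ∃ N, 0 ≤ maxSum T f N (T x) := by
        by_contra! hcon
        refine hx ⟨0, ?_⟩
        rintro _ ⟨n, rfl⟩
        cases n with
        | zero => simp
        | succ n => exact (birkhoffSum_le_maxSum n _).trans (hcon n).le
      refine tendsto_const_nhds.congr' ?_
      filter_upwards [eventually_ge_atTop N] with n hn
      have : 0 ≤ maxSum T f n (T x) := hN.trans (monotone_maxSum (T x) hn)
      simp only [maxSum]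
      rw [max_eq_right this]; ring
  refine ge_of_tendsto' hlim fun n => ?_
  rw [integral_sub (hint _) (hintT n), sub_nonneg]
  have hmp : ∫ x, maxSum T f n (T x) ∂μ = ∫ x, maxSum T f n x ∂μ := by
    rw [← integral_map hT.measurable.aemeasurable (by rw [hT.map_eq]; exact (hint n).1), hT.map_eq]
  rw [hmp]
  exact integral_mono (hint n) (hint _) fun x => monotone_maxSum x n.le_succ

theorem ae_bddAbove_of_integral_neg (hT : Ergodic T μ) (hfm : Measurable f) (hf : Integrable f μ)
    (hneg : ∫ x, f x ∂μ < 0) :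
    ∀ᵐ x ∂μ, BddAbove (Set.range fun n => birkhoffSum T f n x) := by
  have hmeas : ∀ n, Measurable (birkhoffSum T f n) := fun n =>
    Finset.measurable_sum _ fun k _ => hfm.comp (hT.measurable.iterate k)
  have hinv : T ⁻¹' {x | BddAbove (Set.range fun n => birkhoffSum T f n x)} =
      {x | BddAbove (Set.range fun n => birkhoffSum T f n x)} := by
    ext x
    constructor
    · rintro ⟨B, hB⟩
      refine ⟨max 0 (f x + B), ?_⟩
      rintro _ ⟨n, rfl⟩
      cases n with
      | zero => simp
      | succ n =>
        refine le_max_of_le_right ?_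
        simp only [birkhoffSum_succ']
        exact add_le_add le_rfl (hB ⟨n, rfl⟩)
    · rintro ⟨B, hB⟩
      refine ⟨B - f x, ?_⟩
      rintro _ ⟨n, rfl⟩
      have := hB ⟨n + 1, rfl⟩
      simp only [birkhoffSum_succ'] at this
      simp only
      linarith
  rcases hT.toPreErgodic.ae_mem_or_ae_notMem (measurableSet_bddAbove_range hmeas) hinv with h | h
  · exact h
  · exact absurd (integral_nonneg_of_not_bddAbove hT.toMeasurePreserving hf h) (not_le.2 hneg)

theorem ae_eventually_birkhoffAverage_lt [IsProbabilityMeasure μ] (hT : Ergodic T μ)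
    (hfm : Measurable f) (hf : Integrable f μ) {c : ℝ} (hc : ∫ x, f x ∂μ < c) :
    ∀ᵐ x ∂μ, ∀ᶠ n in atTop, birkhoffAverage ℝ T f n x < c := by
  obtain ⟨d, hd, hdc⟩ := exists_between hc
  have key := ae_bddAbove_of_integral_neg (f := fun x => f x - d) hT (hfm.sub_const d)
    (hf.sub (integrable_const d)) (by rw [integral_sub hf (integrable_const d)]; simpa using hd)
  filter_upwards [key] with x ⟨B, hB⟩
  have h1 : Tendsto (fun n : ℕ => d + B / n) atTop (𝓝 (d + 0)) :=
    tendsto_const_nhds.add (tendsto_const_div_atTop_nhds_zero_nat B)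
  filter_upwards [h1.eventually_lt_const (by simpa using hdc), eventually_gt_atTop 0] with n hn hn0
  refine lt_of_le_of_lt ?_ hn
  have hn' : (0 : ℝ) < n := by exact_mod_cast hn0
  have h2 : birkhoffSum T (fun x => f x - d) n x ≤ B := hB ⟨n, rfl⟩
  simp only [birkhoffSum, Finset.sum_sub_distrib, Finset.sum_const, Finset.card_range,
    nsmul_eq_mul] at h2
  simp only [birkhoffAverage, birkhoffSum, smul_eq_mul]
  rw [inv_mul_le_iff₀ hn']
  have : (n : ℝ) * (d + B / n) = n * d + B := by field_simp
  linarith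

/-- **Birkhoff's pointwise ergodic theorem** for an ergodic map of a probability space. -/
theorem ae_tendsto_birkhoffAverage [IsProbabilityMeasure μ] (hT : Ergodic T μ)
    (hfm : Measurable f) (hf : Integrable f μ) :
    ∀ᵐ x ∂μ, Tendsto (fun n => birkhoffAverage ℝ T f n x) atTop (𝓝 (∫ x, f x ∂μ)) := by
  have hup : ∀ k : ℕ, ∀ᵐ x ∂μ, ∀ᶠ n in atTop,
      birkhoffAverage ℝ T f n x < ∫ x, f x ∂μ + 1 / ((k : ℝ) + 1) := fun k =>
    ae_eventually_birkhoffAverage_lt hT hfm hf (lt_add_of_pos_right _ Nat.one_div_pos_of_nat)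
  have hlo : ∀ k : ℕ, ∀ᵐ x ∂μ, ∀ᶠ n in atTop,
      birkhoffAverage ℝ T (fun x => -f x) n x < -∫ x, f x ∂μ + 1 / ((k : ℝ) + 1) := fun k =>
    ae_eventually_birkhoffAverage_lt (f := fun x => -f x) hT hfm.neg hf.neg (by
      rw [integral_neg]; exact lt_add_of_pos_right _ Nat.one_div_pos_of_nat)
  filter_upwards [ae_all_iff.2 hup, ae_all_iff.2 hlo] with x h1 h2
  rw [Metric.tendsto_atTop']
  intro ε hε
  obtain ⟨k, hk⟩ := exists_nat_one_div_lt hε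
  obtain ⟨N, hN⟩ := eventually_atTop.1 ((h1 k).and (h2 k))
  refine ⟨N, fun n hn => ?_⟩
  obtain ⟨ha, hb⟩ := hN n hn.le
  simp only [birkhoffAverage, birkhoffSum, Finset.sum_neg_distrib, smul_neg] at ha hb
  rw [Real.dist_eq, abs_lt]
  simp only [birkhoffAverage, birkhoffSum]
  constructor <;> linarith

end Birkhoff

/-! ### Ergodicity of the stationary chain -/

namespace MarkovPath

theorem tsum_stationary {E : Type*} {Q : E → PMF E} {ρ : PMF E}
    (hρ : JumpChain.IsStationary Q ρ) (ψ : E → ℝ≥0∞) :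
    ∑' x, ρ x * ∑' y, Q x y * ψ y = ∑' y, ρ y * ψ y := by
  simp_rw [← ENNReal.tsum_mul_left]
  rw [ENNReal.tsum_comm]
  refine tsum_congr fun y => ?_
  simp_rw [← mul_assoc]
  rw [ENNReal.tsum_mul_right, hρ y]

theorem eq_of_le_of_tsum_le {ι : Type*} {f g : ι → ℝ≥0∞} (h : f ≤ g) (hf : ∑' i, f i ≠ ∞)
    (hgf : ∑' i, g i ≤ ∑' i, f i) : f = g := by
  by_contra hne
  obtain ⟨i, hi⟩ := Function.ne_iff.1 hne
  exact (ENNReal.tsum_lt_tsum hf h (lt_of_le_of_ne (h i) hi)).not_ge hgf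

/-- In the presence of a stationary distribution, a bounded harmonic function `φ` is invariant
under the possible transitions from the states that are charged. The function `max φ (φ x)` is
subharmonic, hence harmonic at `x` by stationarity, and this forces `φ = φ x` at the successors
of `x`. -/
theorem harmonic_eq_of_step {E : Type*} {Q : E → PMF E} {ρ : PMF E}
    (hρ : JumpChain.IsStationary Q ρ) {φ : E → ℝ≥0∞} (hφ1 : ∀ x, φ x ≤ 1)
    (hφ : ∀ x, φ x = ∑' y, Q x y * φ y) {x y : E} (hx : ρ x ≠ 0) (hxy : Q x y ≠ 0) :
    φ y = φ x := by
  let ψ : E → ℝ≥0∞ := fun z => max (φ z) (φ x)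
  have hconst : ∀ z, ∑' y, Q z y * φ x = φ x := fun z => by
    rw [ENNReal.tsum_mul_right, (Q z).tsum_coe, one_mul]
  have hsub : ∀ z, ψ z ≤ ∑' y, Q z y * ψ y := fun z => by
    refine max_le ?_ ?_
    · exact (hφ z).trans_le (ENNReal.tsum_le_tsum fun y => by gcongr; exact le_max_left _ _)
    · exact (hconst z).symm.trans_le
        (ENNReal.tsum_le_tsum fun y => by gcongr; exact le_max_right _ _)
  have hfin : ∑' z, ρ z * ψ z ≠ ∞ := by
    refine ne_top_of_le_ne_top ENNReal.one_ne_top ?_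
    rw [← ρ.tsum_coe]
    exact ENNReal.tsum_le_tsum fun z => mul_le_of_le_one_right' (max_le (hφ1 _) (hφ1 _))
  have h1 := congrFun (eq_of_le_of_tsum_le (f := fun z => ρ z * ψ z)
    (g := fun z => ρ z * ∑' y, Q z y * ψ y) (fun z => by dsimp only; gcongr; exact hsub z) hfin
    (tsum_stationary hρ ψ).le) x
  have h2 : φ x = ∑' y, Q x y * ψ y := by
    have := (ENNReal.mul_right_inj hx (ρ.apply_ne_top x)).1 h1
    rwa [show ψ x = φ x from max_self _] at this
  have hxfin : φ x ≠ ∞ := ne_top_of_le_ne_top ENNReal.one_ne_top (hφ1 x)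
  have h3 := congrFun (eq_of_le_of_tsum_le (f := fun z => Q x z * φ z) (g := fun z => Q x z * ψ z)
    (fun z => by dsimp only; gcongr; exact le_max_left _ _) (by rwa [← hφ])
    (by rw [← h2, ← hφ])) y
  have h4 := congrFun (eq_of_le_of_tsum_le (f := fun z => Q x z * φ x) (g := fun z => Q x z * ψ z)
    (fun z => by dsimp only; gcongr; exact le_max_right _ _) (by rwa [hconst])
    (by rw [← h2, hconst])) y
  exact (ENNReal.mul_right_inj hxy ((Q x).apply_ne_top y)).1 (h3.trans h4.symm)

theorem stationary_step_ne_zero {E : Type*} {Q : E → PMF E} {ρ : PMF E}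
    (hρ : JumpChain.IsStationary Q ρ) {x y : E} (hx : ρ x ≠ 0) (hxy : Q x y ≠ 0) : ρ y ≠ 0 := by
  rw [← hρ y]
  exact fun h => mul_ne_zero hx hxy (ENNReal.tsum_eq_zero.1 h x)

variable {E : Type*} [Countable E] [MeasurableSpace E] [MeasurableSingletonClass E]

theorem measurePreserving_shift {Q : E → PMF E} {ρ : PMF E} (hρ : JumpChain.IsStationary Q ρ) :
    MeasurePreserving shift (mixLaw Q ρ) (mixLaw Q ρ) := by
  refine ⟨measurable_shift, Measure.ext fun B hB => ?_⟩
  rw [Measure.map_apply measurable_shift hB, mixLaw_apply Q ρ (measurable_shift hB),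
    mixLaw_apply Q ρ hB]
  simp_rw [pathLaw_shift_preimage Q _ hB]
  exact tsum_stationary hρ _

/-- The shift is ergodic under the law of the stationary chain, if any two charged states
communicate. For an invariant event `A` the function `x ↦ pathLaw Q x A` is harmonic, hence
constant on the charged states; by the Markov property `A` is then independent of all cylinders,
hence of itself. -/
theorem ergodic_shift {Q : E → PMF E} {ρ : PMF E} (hρ : JumpChain.IsStationary Q ρ)
    (hirr : ∀ x y, ρ x ≠ 0 → ρ y ≠ 0 → Relation.ReflTransGen (fun a b => 0 < Q a b) x y) :
    Ergodic shift (mixLaw Q ρ) := by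
  refine ⟨measurePreserving_shift hρ, ⟨fun A hA hinv => ?_⟩⟩
  obtain ⟨x₀, hx₀⟩ := ρ.support_nonempty
  have hharm : ∀ x, pathLaw Q x A = ∑' y, Q x y * pathLaw Q y A := fun x => by
    rw [← pathLaw_shift_preimage Q x hA, hinv]
  have hconst : ∀ x, ρ x ≠ 0 → pathLaw Q x A = pathLaw Q x₀ A := fun x hx => by
    suffices ρ x ≠ 0 ∧ pathLaw Q x A = pathLaw Q x₀ A from this.2
    have hpath := hirr x₀ x hx₀ hx
    clear hx
    induction hpath with
    | refl => exact ⟨hx₀, rfl⟩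
    | tail _ hbc ih =>
      exact ⟨stationary_step_ne_zero hρ ih.1 hbc.ne',
        (harmonic_eq_of_step hρ (fun _ => prob_le_one) hharm ih.1 hbc.ne').trans ih.2⟩
  have hrestr : (mixLaw Q ρ).restrict A = pathLaw Q x₀ A • mixLaw Q ρ := by
    refine ext_cyl fun n w => ?_
    rw [Measure.restrict_apply (measurableSet_cyl n w), Measure.smul_apply, smul_eq_mul,
      Set.inter_comm, mul_comm]
    have hAn : shift^[n] ⁻¹' A = A := Function.IsFixedPt.preimage_iterate hinv n
    have hmk := mixLaw_cyl_inter Q (a := ρ) n w hA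
    rw [hAn] at hmk
    rw [hmk]
    by_cases h0 : mixLaw Q ρ (cyl n w) = 0
    · simp [h0]
    · rw [hconst]
      intro hzero
      refine h0 (measure_mono_null (t := shift^[n] ⁻¹' cyl 0 fun _ => w n) ?_ ?_)
      · intro ω hω k hk
        rw [shift_iterate, Nat.le_zero.1 hk, zero_add]
        exact hω n le_rfl
      · rw [((measurePreserving_shift hρ).iterate n).measure_preimage
          (measurableSet_cyl _ _).nullMeasurableSet, mixLaw_cyl, hzero, zero_mul]
  have hc : mixLaw Q ρ A = pathLaw Q x₀ A := by
    simpa using congrArg (fun m => m Set.univ) hrestr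
  have hmul : pathLaw Q x₀ A * mixLaw Q ρ Aᶜ = 0 := by
    simpa [Measure.restrict_apply hA.compl] using (congrArg (fun m => m Aᶜ) hrestr).symm
  rw [eventuallyConst_set']
  rcases mul_eq_zero.1 hmul with h | h
  · exact .inl (ae_eq_empty.2 (hc.trans h))
  · exact .inr (ae_eq_univ.2 h)

theorem map_eval_zero_mixLaw (Q : E → PMF E) (ρ : PMF E) :
    (mixLaw Q ρ).map (fun ω => ω 0) = ρ.toMeasure := by
  refine Measure.ext_of_singleton fun x => ?_
  rw [Measure.map_apply (measurable_pi_apply 0) (measurableSet_singleton x),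
    PMF.toMeasure_apply_singleton _ _ (measurableSet_singleton _)]
  have : (fun ω : ℕ → E => ω 0) ⁻¹' {x} = cyl 0 fun _ => x := by ext ω; simp [cyl]
  rw [this, mixLaw_cyl]
  simp [weight]

/-! ### The ergodic theorem for Markov chains -/

theorem map_path_eq_mixLaw {Q : E → PMF E} {Ω : Type*} [MeasurableSpace Ω] {μ : Measure Ω}
    [IsProbabilityMeasure μ] {Y : ℕ → Ω → E}
    (hY : JumpChain.IsMarkovChain μ (fun x y => Q x y) Y) :
    μ.map (fun ω n => Y n ω) = mixLaw Q fun x => μ {ω | Y 0 ω = x} := by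
  have hmeas : Measurable fun ω n => Y n ω := measurable_pi_lambda _ hY.1
  have := Measure.isFiniteMeasure_map μ fun ω n => Y n ω
  refine eq_mixLaw fun n w => ?_
  rw [Measure.map_apply hmeas (measurableSet_cyl n w)]
  change μ {ω | ∀ k ≤ n, Y k ω = w k} = _
  induction n with
  | zero => simp [weight]
  | succ n ih => rw [hY.2, ih, weight, weight, Finset.prod_range_succ, mul_assoc]

/-- The ergodic theorem for a Markov chain with stationary distribution `ρ`, started in states
charged by `ρ`: the path law is absolutely continuous with respect to that of the stationary
chain, to which Birkhoff's theorem applies. -/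
theorem ae_tendsto_average {Q : E → PMF E} {ρ : PMF E} (hρ : JumpChain.IsStationary Q ρ)
    (hirr : ∀ x y, ρ x ≠ 0 → ρ y ≠ 0 → Relation.ReflTransGen (fun a b => 0 < Q a b) x y)
    {Ω : Type*} [MeasurableSpace Ω] {μ : Measure Ω} [IsProbabilityMeasure μ] {Y : ℕ → Ω → E}
    (hY : JumpChain.IsMarkovChain μ (fun x y => Q x y) Y)
    (hY0 : ∀ x, ρ x = 0 → μ {ω | Y 0 ω = x} = 0) {f : E → ℝ} (hf : Integrable f ρ.toMeasure) :
    ∀ᵐ ω ∂μ, Tendsto (fun n : ℕ => (n : ℝ)⁻¹ * ∑ k ∈ Finset.range n, f (Y k ω)) atTop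
      (𝓝 (∫ x, f x ∂ρ.toMeasure)) := by
  have hfm : Measurable f := measurable_of_countable f
  have h0 : MeasurePreserving (fun ω : ℕ → E => ω 0) (mixLaw Q ρ) ρ.toMeasure :=
    ⟨measurable_pi_apply 0, map_eval_zero_mixLaw Q ρ⟩
  have hint : ∫ ω, f (ω 0) ∂mixLaw Q ρ = ∫ x, f x ∂ρ.toMeasure := by
    rw [← h0.map_eq, integral_map h0.measurable.aemeasurable hfm.aestronglyMeasurable]
  have hB := Birkhoff.ae_tendsto_birkhoffAverage (f := fun ω : ℕ → E => f (ω 0))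
    (ergodic_shift hρ hirr) (hfm.comp (measurable_pi_apply 0)) (h0.integrable_comp_of_integrable hf)
  have hac : μ.map (fun ω n => Y n ω) ≪ mixLaw Q ρ := by
    rw [map_path_eq_mixLaw hY]
    refine Measure.AbsolutelyContinuous.mk fun B hBm hB0 => ?_
    rw [mixLaw_apply Q _ hBm, ENNReal.tsum_eq_zero] at hB0 ⊢
    intro x
    rcases mul_eq_zero.1 (hB0 x) with h | h
    · rw [hY0 x h, zero_mul]
    · rw [h, mul_zero]
  filter_upwards [ae_of_ae_map (measurable_pi_lambda _ hY.1).aemeasurable (hac.ae_le hB)] with ω hω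
  rw [hint] at hω
  simpa only [birkhoffAverage, birkhoffSum, shift_iterate, zero_add, smul_eq_mul] using hω

end MarkovPath

/-! ### Geometric multiplicities -/

namespace JumpChain

theorem multProb_succ (p : ℝ≥0∞) (m : ℕ) : multProb p (m + 1) = (1 - p) ^ m * p := by
  simp [multProb]

theorem tsum_multProb {p : ℝ≥0∞} (h0 : p ≠ 0) (h1 : p ≤ 1) : ∑' m, multProb p m = 1 := by
  rw [tsum_eq_zero_add' ENNReal.summable]
  simp_rw [multProb_succ]
  rw [ENNReal.tsum_mul_right, ENNReal.tsum_geometric,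
    ENNReal.sub_sub_cancel ENNReal.one_ne_top h1,
    ENNReal.inv_mul_cancel h0 (ne_top_of_le_ne_top ENNReal.one_ne_top h1)]
  simp [multProb]

theorem hasSum_mul_multProb {p : ℝ≥0∞} (h0 : p ≠ 0) (h1 : p ≤ 1) :
    HasSum (fun m : ℕ => (m : ℝ) * (multProb p m).toReal) p.toReal⁻¹ := by
  have hp : p ≠ ∞ := ne_top_of_le_ne_top ENNReal.one_ne_top h1
  have hq0 : 0 < p.toReal := ENNReal.toReal_pos h0 hp
  have hq1 : p.toReal ≤ 1 := by simpa using ENNReal.toReal_mono ENNReal.one_ne_top h1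
  rw [← hasSum_nat_add_iff' 1]
  have hr : ‖1 - p.toReal‖ < 1 := by rw [Real.norm_eq_abs, abs_lt]; constructor <;> linarith
  have hsum := ((hasSum_coe_mul_geometric_of_norm_lt_one hr).add
    (hasSum_geometric_of_norm_lt_one hr)).mul_right p.toReal
  have hterm : ∀ m : ℕ, ((m + 1 : ℕ) : ℝ) * (multProb p (m + 1)).toReal =
      (m * (1 - p.toReal) ^ m + (1 - p.toReal) ^ m) * p.toReal := fun m => by
    rw [multProb_succ, ENNReal.toReal_mul, ENNReal.toReal_pow,
      ENNReal.toReal_sub_of_le h1 ENNReal.one_ne_top]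
    push_cast
    rw [ENNReal.toReal_one]
    ring
  have hval : p.toReal⁻¹ - ∑ i ∈ Finset.range 1, (i : ℝ) * (multProb p i).toReal =
      ((1 - p.toReal) / (1 - (1 - p.toReal)) ^ 2 + (1 - (1 - p.toReal))⁻¹) * p.toReal := by
    simp only [Finset.sum_range_one, Nat.cast_zero, zero_mul, sub_zero, sub_sub_cancel]
    field_simp
    ring
  rw [hval]
  simp_rw [hterm]
  exact hsum

/-! ### The jump chain -/

theorem escapeProb_le_one {S : Type*} (P : S → PMF S) (x : S) : escapeProb P x ≤ 1 :=
  tsub_le_self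

theorem escapeProb_ne_top {S : Type*} (P : S → PMF S) (x : S) : escapeProb P x ≠ ∞ :=
  ne_top_of_le_ne_top ENNReal.one_ne_top (escapeProb_le_one P x)

theorem escapeProb_add {S : Type*} (P : S → PMF S) (x : S) : escapeProb P x + P x x = 1 :=
  tsub_add_cancel_of_le ((P x).coe_le_one x)

theorem escapeProb_ne_zero_of_step {S : Type*} {P : S → PMF S} {x y : S} (hne : y ≠ x)
    (hxy : P x y ≠ 0) : escapeProb P x ≠ 0 := by
  rw [escapeProb_eq_tsum]
  exact fun h => hxy (ENNReal.tsum_eq_zero.1 h ⟨y, hne⟩)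

theorem escapeProb_ne_zero {S : Type*} [Nontrivial S] {P : S → PMF S} (hP : IsIrreducible P)
    (x : S) : escapeProb P x ≠ 0 := by
  obtain ⟨y, hy⟩ := exists_ne x
  intro h0
  suffices ∀ z, Relation.ReflTransGen (fun a b => 0 < P a b) x z → z = x from hy (this y (hP x y))
  intro z hz
  induction hz with
  | refl => rfl
  | tail _ hbc ih =>
    subst ih
    by_contra hne
    exact escapeProb_ne_zero_of_step hne hbc.ne' h0

open Classical in
theorem escapeProb_mul_jumpProb {S : Type*} (P : S → PMF S) {x : S} (hx : escapeProb P x ≠ 0)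
    (y : S) : escapeProb P x * jumpProb P x y = if y = x then 0 else P x y := by
  unfold jumpProb
  split_ifs
  · simp
  · exact ENNReal.mul_div_cancel hx (escapeProb_ne_top P x)

theorem tsum_jumpProb {S : Type*} (P : S → PMF S) {x : S} (hx : escapeProb P x ≠ 0) :
    ∑' y, jumpProb P x y = 1 := by
  classical
  have h := ENNReal.tsum_eq_add_tsum_ite (f := P x) x
  rw [(P x).tsum_coe, ← escapeProb_add P x, add_comm,
    ENNReal.add_right_inj ((P x).apply_ne_top x)] at h
  rw [← ENNReal.mul_right_inj hx (escapeProb_ne_top P x), ← ENNReal.tsum_mul_left, mul_one]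
  simp_rw [escapeProb_mul_jumpProb P hx]
  exact h.symm

/-- The weights `π x * escapeProb P x` are stationary for the jump chain. -/
theorem tsum_mul_jumpProb {S : Type*} {P : S → PMF S} (hα : ∀ x, escapeProb P x ≠ 0) {π : PMF S}
    (hπ : IsStationary P π) (y : S) :
    ∑' x, π x * escapeProb P x * jumpProb P x y = π y * escapeProb P y := by
  classical
  have hfin : π y * P y y ≠ ∞ := ENNReal.mul_ne_top (π.apply_ne_top y) ((P y).apply_ne_top y)
  rw [← ENNReal.add_right_inj hfin, ← mul_add, add_comm (P y y), escapeProb_add, mul_one]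
  refine Eq.trans ?_ (hπ y)
  rw [ENNReal.tsum_eq_add_tsum_ite (f := fun x => π x * P x y) y]
  congr 1
  refine tsum_congr fun x => ?_
  rw [mul_assoc, escapeProb_mul_jumpProb P (hα x)]
  by_cases hxy : x = y
  · simp [hxy]
  · simp [hxy, Ne.symm hxy]

theorem stationary_ne_zero {S : Type*} {P : S → PMF S} (hP : IsIrreducible P) {π : PMF S}
    (hπ : IsStationary P π) (x : S) : π x ≠ 0 := by
  obtain ⟨x₀, hx₀⟩ := π.support_nonempty
  induction hP x₀ x with
  | refl => exact hx₀
  | tail _ hbc ih => exact MarkovPath.stationary_step_ne_zero hπ ih hbc.ne'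

/-- The jump chain reaches every state, in at least one step. -/
theorem transGen_jumpProb {S : Type*} [Nontrivial S] {P : S → PMF S} (hP : IsIrreducible P)
    (x y : S) : Relation.TransGen (fun a b => 0 < jumpProb P a b) x y := by
  have hrefl : ∀ x y, Relation.ReflTransGen (fun a b => 0 < jumpProb P a b) x y := fun x y => by
    induction hP x y with
    | refl => exact .refl
    | @tail b c _ hbc ih =>
      by_cases hcb : c = b
      · rwa [hcb]
      · refine ih.tail ?_
        simp only [jumpProb, if_neg hcb]
        exact ENNReal.div_pos hbc.ne' (escapeProb_ne_top P b)
  have hne : ∀ x y, y ≠ x → Relation.TransGen (fun a b => 0 < jumpProb P a b) x y :=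
    fun x y h => (Relation.reflTransGen_iff_eq_or_transGen.1 (hrefl x y)).resolve_left h
  obtain ⟨z, hz⟩ := exists_ne x
  exact (hne x z hz).trans_left (hrefl z y)

/-! ### The chain of states and multiplicities -/

/-- The transition probabilities of the Markov chain `(J k, M k)`: from `(x, m)` it moves to
`(y, m')` with probability `jumpProb P x y * multProb (escapeProb P y) m'`. -/
noncomputable def pairStep {S : Type*} (P : S → PMF S) (hα : ∀ x, escapeProb P x ≠ 0)
    (a : S × ℕ) : PMF (S × ℕ) :=
  ⟨fun b => jumpProb P a.1 b.1 * multProb (escapeProb P b.1) b.2, by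
    rw [ENNReal.summable.hasSum_iff, ENNReal.tsum_prod']
    simp_rw [ENNReal.tsum_mul_left, tsum_multProb (hα _) (escapeProb_le_one P _), mul_one]
    exact tsum_jumpProb P (hα a.1)⟩

theorem pairStep_apply {S : Type*} (P : S → PMF S) (hα : ∀ x, escapeProb P x ≠ 0)
    (a b : S × ℕ) :
    pairStep P hα a b = jumpProb P a.1 b.1 * multProb (escapeProb P b.1) b.2 := rfl

/-- The unnormalized stationary weights of the chain `(J k, M k)`. -/
noncomputable def pairWeight {S : Type*} (P : S → PMF S) (π : PMF S) (a : S × ℕ) : ℝ≥0∞ :=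
  π a.1 * escapeProb P a.1 * multProb (escapeProb P a.1) a.2

theorem tsum_pairWeight {S : Type*} {P : S → PMF S} (hα : ∀ x, escapeProb P x ≠ 0) (π : PMF S) :
    ∑' a, pairWeight P π a = ∑' x, π x * escapeProb P x := by
  rw [ENNReal.tsum_prod']
  simp_rw [pairWeight, ENNReal.tsum_mul_left, tsum_multProb (hα _) (escapeProb_le_one P _),
    mul_one]

theorem tsum_pairWeight_ne_zero {S : Type*} {P : S → PMF S} (hα : ∀ x, escapeProb P x ≠ 0)
    (π : PMF S) : ∑' a, pairWeight P π a ≠ 0 := by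
  obtain ⟨x, hx⟩ := π.support_nonempty
  rw [tsum_pairWeight hα]
  exact fun h => mul_ne_zero hx (hα x) (ENNReal.tsum_eq_zero.1 h x)

theorem tsum_pairWeight_ne_top {S : Type*} {P : S → PMF S} (hα : ∀ x, escapeProb P x ≠ 0)
    (π : PMF S) : ∑' a, pairWeight P π a ≠ ∞ := by
  rw [tsum_pairWeight hα]
  refine ne_top_of_le_ne_top ENNReal.one_ne_top ?_
  rw [← π.tsum_coe]
  exact ENNReal.tsum_le_tsum fun x => mul_le_of_le_one_right' (escapeProb_le_one P x)

/-- The stationary distribution of the chain `(J k, M k)`. -/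
noncomputable def pairStationary {S : Type*} (P : S → PMF S) (hα : ∀ x, escapeProb P x ≠ 0)
    (π : PMF S) : PMF (S × ℕ) :=
  PMF.normalize (pairWeight P π) (tsum_pairWeight_ne_zero hα π) (tsum_pairWeight_ne_top hα π)

theorem isStationary_pairStationary {S : Type*} {P : S → PMF S} (hα : ∀ x, escapeProb P x ≠ 0)
    {π : PMF S} (hπ : IsStationary P π) :
    IsStationary (pairStep P hα) (pairStationary P hα π) := by
  intro b
  have hterm : ∀ a : S × ℕ, pairStationary P hα π a * pairStep P hα a b =
      pairWeight P π a * jumpProb P a.1 b.1 *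
        ((∑' a, pairWeight P π a)⁻¹ * multProb (escapeProb P b.1) b.2) := fun a => by
    rw [pairStationary, PMF.normalize_apply, pairStep_apply]; ring
  simp_rw [hterm]
  rw [ENNReal.tsum_mul_right, ENNReal.tsum_prod', pairStationary, PMF.normalize_apply]
  have hx : ∀ x, ∑' m, pairWeight P π (x, m) * jumpProb P x b.1 =
      π x * escapeProb P x * jumpProb P x b.1 := fun x => by
    simp_rw [ENNReal.tsum_mul_right, pairWeight, ENNReal.tsum_mul_left,
      tsum_multProb (hα x) (escapeProb_le_one P x), mul_one]
  simp_rw [hx, tsum_mul_jumpProb hα hπ, pairWeight]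
  ring

theorem pairStationary_eq_zero_iff {S : Type*} {P : S → PMF S} (hα : ∀ x, escapeProb P x ≠ 0)
    {π : PMF S} (hπ0 : ∀ x, π x ≠ 0) (a : S × ℕ) :
    pairStationary P hα π a = 0 ↔ multProb (escapeProb P a.1) a.2 = 0 := by
  rw [pairStationary, PMF.normalize_apply, mul_eq_zero, ENNReal.inv_eq_zero,
    or_iff_left (tsum_pairWeight_ne_top hα π)]
  simp [pairWeight, hπ0, hα]

theorem reflTransGen_pairStep {S : Type*} [Nontrivial S] {P : S → PMF S} (hP : IsIrreducible P)
    (hα : ∀ x, escapeProb P x ≠ 0) (a b : S × ℕ) (hb : multProb (escapeProb P b.1) b.2 ≠ 0) :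
    Relation.ReflTransGen (fun a b => 0 < pairStep P hα a b) a b := by
  obtain ⟨y, m⟩ := b
  have hpath := transGen_jumpProb hP a.1 y
  induction hpath generalizing m with
  | single h => exact .single (pos_iff_ne_zero.2 (mul_ne_zero h.ne' hb))
  | tail _ h ih =>
    exact (ih 1 (by simpa [multProb] using hα _)).tail (pos_iff_ne_zero.2 (mul_ne_zero h.ne' hb))

/-- Under the stationary distribution of `(J k, M k)`, the mean of `M k * h (J k)` is that of `h`
under `π` up to the normalizing constant: the mean `1 / escapeProb P x` of the multiplicity
cancels the weight `escapeProb P x`. -/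
theorem hasSum_pairStationary {S : Type*} {P : S → PMF S} (hα : ∀ x, escapeProb P x ≠ 0)
    (π : PMF S) {h : S → ℝ} (hh : Summable fun x => (π x).toReal * |h x|) :
    HasSum (fun a : S × ℕ => (pairStationary P hα π a).toReal * (a.2 * h a.1))
      ((∑' a, pairWeight P π a).toReal⁻¹ * ∑' x, (π x).toReal * h x) := by
  set c := (∑' a, pairWeight P π a).toReal
  have hα' : ∀ x, (escapeProb P x).toReal ≠ 0 := fun x =>
    (ENNReal.toReal_pos (hα x) (escapeProb_ne_top P x)).ne'
  have hterm : ∀ (g : S → ℝ) (x : S), HasSum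
      (fun m : ℕ => (pairStationary P hα π (x, m)).toReal * (m * g x))
      (c⁻¹ * ((π x).toReal * g x)) := fun g x => by
    have := (hasSum_mul_multProb (hα x) (escapeProb_le_one P x)).mul_left
      (c⁻¹ * ((π x).toReal * g x) * (escapeProb P x).toReal)
    rw [mul_inv_cancel_right₀ (hα' x)] at this
    refine Eq.mp (congrArg (HasSum · _) (funext fun m => ?_)) this
    simp only [pairStationary, PMF.normalize_apply, pairWeight, ENNReal.toReal_mul,
      ENNReal.toReal_inv, c]
    ring
  have hsum : Summable fun a : S × ℕ => (pairStationary P hα π a).toReal * (a.2 * h a.1) := by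
    rw [← summable_norm_iff]
    have hnorm : ∀ a : S × ℕ, ‖(pairStationary P hα π a).toReal * (a.2 * h a.1)‖ =
        (pairStationary P hα π a).toReal * (a.2 * |h a.1|) := fun a => by
      simp
    simp only [hnorm]
    rw [summable_prod_of_nonneg fun a => by positivity]
    refine ⟨fun x => (hterm (fun x => |h x|) x).summable, ?_⟩
    refine (hh.mul_left c⁻¹).congr fun x => ?_
    exact (hterm (fun x => |h x|) x).tsum_eq.symm
  have htot := hsum.hasSum.prod_fiberwise fun x => hterm h x
  rw [← tsum_mul_left, htot.tsum_eq]
  exact hsum.hasSum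

theorem integrable_pmf_of_summable {E : Type*} [Countable E] [MeasurableSpace E]
    [MeasurableSingletonClass E] (ρ : PMF E) {f : E → ℝ}
    (hf : Summable fun a => (ρ a).toReal * f a) : Integrable f ρ.toMeasure := by
  refine ⟨(measurable_of_countable f).aestronglyMeasurable, ?_⟩
  rw [HasFiniteIntegral, lintegral_countable']
  have : ∀ a, ‖f a‖ₑ * ρ.toMeasure {a} = ENNReal.ofReal ‖(ρ a).toReal * f a‖ := fun a => by
    rw [PMF.toMeasure_apply_singleton _ _ (measurableSet_singleton a), norm_mul,
      ENNReal.ofReal_mul (norm_nonneg _), ofReal_norm (f a), Real.norm_eq_abs,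
      abs_of_nonneg ENNReal.toReal_nonneg, ENNReal.ofReal_toReal (ρ.apply_ne_top a), mul_comm]
  simp_rw [this]
  exact hf.norm.tsum_ofReal_lt_top

theorem isMarkovChain_pair {S : Type*} [MeasurableSpace S] {P : S → PMF S}
    (hα : ∀ x, escapeProb P x ≠ 0) {Ω : Type*} [MeasurableSpace Ω] {μ : Measure Ω}
    {J : ℕ → Ω → S} {M : ℕ → Ω → ℕ} (hJ : IsMarkovChain μ (jumpProb P) J)
    (hM : IsMultiplicityList μ (escapeProb P) J M) :
    IsMarkovChain μ (fun a b => pairStep P hα a b) fun k ω => (J k ω, M k ω) := by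
  refine ⟨fun n => (hJ.1 n).prodMk (hM.1 n), fun n x => ?_⟩
  have h1 := hM.2 (n + 1) (fun k => (x k).1) (fun k => (x k).2)
  have h0 := hM.2 n (fun k => (x k).1) (fun k => (x k).2)
  rw [hJ.2, Finset.prod_range_succ] at h1
  simp only [Prod.ext_iff, h0, h1, pairStep_apply]
  ring

/-! ### The estimator -/

theorem sum_Icc_one_eq_sum_range (f : ℕ → ℝ) (L : ℕ) :
    ∑ k ∈ Finset.Icc 1 L, f k = ∑ k ∈ Finset.range L, f (k + 1) := by
  induction L with
  | zero => simp
  | succ L ih => rw [Finset.sum_Icc_succ_top (by omega), ih, Finset.sum_range_succ]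

end JumpChain

/-- The jump chain and its multiplicities are indexed by `k = 1, 2, …`; the values at `k = 0` play
no role. -/
theorem theorem1 {S : Type*} [Countable S] [Nontrivial S]
    [MeasurableSpace S] [MeasurableSingletonClass S]
    (P : S → PMF S) (hP : JumpChain.IsIrreducible P)
    (π : PMF S) (hπ : JumpChain.IsStationary P π)
    (h : S → ℝ) (hh : Summable fun x => (π x).toReal * |h x|)
    {Ω : Type*} [MeasurableSpace Ω] (μ : Measure Ω) [IsProbabilityMeasure μ]
    (J : ℕ → Ω → S) (M : ℕ → Ω → ℕ)
    (hJ : JumpChain.IsMarkovChain μ (JumpChain.jumpProb P) (fun k => J (k + 1)))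
    (hM : JumpChain.IsMultiplicityList μ (JumpChain.escapeProb P)
      (fun k => J (k + 1)) (fun k => M (k + 1))) :
    ∀ᵐ ω ∂μ, Tendsto (fun L => JumpChain.weightedEstimator h J M L ω) atTop
      (𝓝 (∑' x, (π x).toReal * h x)) := by
  have hα := JumpChain.escapeProb_ne_zero hP
  have hπ0 := JumpChain.stationary_ne_zero hP hπ
  have hzero := JumpChain.pairStationary_eq_zero_iff hα hπ0
  -- the ergodic theorem for the chain `(J k, M k)` and the function `(x, m) ↦ m * g x`
  have hlim : ∀ g : S → ℝ, (Summable fun x => (π x).toReal * |g x|) →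
      ∀ᵐ ω ∂μ, Tendsto (fun n : ℕ => (n : ℝ)⁻¹ *
        ∑ k ∈ Finset.range n, ((M (k + 1) ω : ℝ) * g (J (k + 1) ω))) atTop
        (𝓝 ((∑' a, JumpChain.pairWeight P π a).toReal⁻¹ * ∑' x, (π x).toReal * g x)) := by
    intro g hg
    have hs := JumpChain.hasSum_pairStationary hα π hg
    have hint := JumpChain.integrable_pmf_of_summable _ hs.summable
    have key := MarkovPath.ae_tendsto_average (JumpChain.isStationary_pairStationary hα hπ)
      (fun a b _ hb => JumpChain.reflTransGen_pairStep hP hα a b ((hzero b).not.1 hb))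
      (JumpChain.isMarkovChain_pair hα hJ hM) (fun a ha => ?_) hint
    · rw [PMF.integral_eq_tsum _ _ hint] at key
      simp only [smul_eq_mul, hs.tsum_eq] at key
      exact key
    · have h0 := hM.2 0 (fun _ => a.1) (fun _ => a.2)
      simpa [Prod.ext_iff, (hzero a).1 ha] using h0
  have hπsum : HasSum (fun x => (π x).toReal) 1 := by
    have := ENNReal.hasSum_toReal (f := π) (by rw [π.tsum_coe]; exact ENNReal.one_ne_top)
    rwa [← ENNReal.tsum_toReal_eq π.apply_ne_top, π.tsum_coe, ENNReal.toReal_one] at this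
  have hc : (∑' a, JumpChain.pairWeight P π a).toReal⁻¹ ≠ 0 :=
    inv_ne_zero (ENNReal.toReal_pos (JumpChain.tsum_pairWeight_ne_zero hα π)
      (JumpChain.tsum_pairWeight_ne_top hα π)).ne'
  -- the estimator is the ratio of the averages for `g = h` and for `g = 1`
  filter_upwards [hlim h hh, hlim (fun _ => 1) (by simpa using hπsum.summable)] with ω hω hω1
  simp only [mul_one, hπsum.tsum_eq] at hω1
  have hdiv := hω.div hω1 hc
  rw [mul_div_cancel_left₀ _ hc] at hdiv
  refine hdiv.congr' ?_
  filter_upwards [eventually_gt_atTop 0] with L hL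
  have hL' : (L : ℝ)⁻¹ ≠ 0 := inv_ne_zero (by exact_mod_cast hL.ne')
  simp only [Pi.div_apply, JumpChain.weightedEstimator, JumpChain.sum_Icc_one_eq_sum_range]
  exact mul_div_mul_left _ _ hL'
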